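/- Densities are Borel probability densities on $\mathbb{R}^d$ with respect to Lebesgue measure, and $\|\cdot\|$ is the Euclidean norm. For a density $f$ write $F(A)=\int_A f(x)\,\mathrm{d}x$, $\operatorname{supp}(f)=\{x\in\mathbb{R}^d: f(x)>0\}$, and $$\mathrm{KL}(f\|g)=\int_{\mathbb{R}^d} f(x)\log\frac{f(x)}{g(x)}\,\mathrm{d}x\in[0,\infty].$$ Let $\log_+ t=\max\{\log t,0\}$. Let $\mathcal M$ be the set of all finite Gaussian mixture densities $x\mapsto\sum_{j=1}^m\pi_j\varphi(x;\mu_j,\Sigma_j)$ with $m\in\mathbb N$, $\pi_j\ge0$, $\sum_j\pi_j=1$, $\mu_j\in\mathbb{R}^d$ and $\Sigma_j$ symmetric positive definite, where $\varphi(\cdot;\mu,\Sigma)$ is the density of the normal distribution with mean $\mu$ and covariance matrix $\Sigma$. All cubes are axis-aligned and have positive side length. They are closed, except that in a partition a cube may be a product of intervals of a common length each of which contains or omits either of its endpoints. Cubes of common side length are adjacent if they have pairwise disjoint interiors and the union of their closures is connected. Fixed-scale condition. Let $q$ be a density. We say that $q$ satisfies the fixed-scale support-aware condition with a scale $r>0$,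 closed cubes $C(y)\ni y$ of side length $r$ for $y\in\operatorname{supp}(q)$, and, for every $m\ge1$, a partition $\operatorname{supp}(q)=A^{(m)}_0\sqcup A^{(m)}_1\sqcup\dots\sqcup A^{(m)}_m$ in which $A^{(m)}_1,\dots,A^{(m)}_m$ are adjacent cubes with a common side length $h_m>0$ and $A^{(m)}_0$ is the remainder, if, with $Q$ the probability measure with density $q$: (i) the restriction of $q$ to $\operatorname{supp}(q)$ is continuous at every point of $\operatorname{supp}(q)$ outside a set of $Q$-measure zero; (ii) the function $D(y)=\log\bigl(q(y)/\inf_{z\in C(y)}q(z)\bigr)\in[0,\infty]$ (equal to $\infty$ if the infimum is $0$) is measurable on $\operatorname{supp}(q)$ and $\int_{\operatorname{supp}(q)}D\,\mathrm{d}Q<\infty$; (iii) there is $M\in\mathbb N$ such that for every $m\ge M$: if $y\in A^{(m)}_0$, then $C(y)\cap A^{(m)}_0$ contains a closed cube of side length $r/2$ with a vertex at $y$; and if $y\in\operatorname{supp}(q)\setminus A^{(m)}_0$, then $C(y)\cap(\operatorname{supp}(q)\setminus A^{(m)}_0)$ contains a closed cube of side length $r/2$ with a vertex at $y$. Countable-scale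 class. A density $f$ belongs to $\mathcal F_{\mathrm{CSSA}}$ if there is a partition $\operatorname{supp}(f)=\bigsqcup_{\ell\ge1}Y_\ell$ into measurable sets, with $p_\ell=F(Y_\ell)\ge0$, such that for every $\ell$ with $p_\ell>0$ the density $f_\ell=f\mathbf 1_{Y_\ell}/p_\ell$ (whose support is $Y_\ell$) satisfies the fixed-scale support-aware condition with some scale $r_\ell>0$, cubes $C_\ell(y)$ for $y\in Y_\ell$, and partitions of $Y_\ell$, where, with $F_\ell$ the probability measure with density $f_\ell$ and $D_\ell(y)=\log\bigl(f_\ell(y)/\inf_{z\in C_\ell(y)}f_\ell(z)\bigr)$, $$\sum_{\ell:\,p_\ell>0}p_\ell\int_{Y_\ell}D_\ell\,\mathrm{d}F_\ell<\infty\qquad\text{and}\qquad\sum_{\ell:\,p_\ell>0}p_\ell\log_+\frac1{r_\ell}<\infty .$$ Theorem. If $f\in\mathcal F_{\mathrm{CSSA}}$, then $$\inf_{g\in\mathcal M}\mathrm{KL}(f\|g)=0\quad\Longleftrightarrow\quad\int_{\mathbb{R}^d}\|x\|^2f(x)\,\mathrm{d}x<\infty .$$ -/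

import Mathlib

open scoped ENNReal Matrix

namespace GMM

/-- `ℝ^d` with the Euclidean norm and Lebesgue measure. -/
abbrev E (d : ℕ) := EuclideanSpace ℝ (Fin d)

/-- Borel probability densities on `ℝ^d` with respect to Lebesgue measure. -/
structure IsDensity {d : ℕ} (f : E d → ℝ) : Prop where
  measurable : Measurable f
  nonneg : ∀ x, 0 ≤ f x
  lintegral_eq_one : ∫⁻ x, ENNReal.ofReal (f x) = 1

/-- The measure `F(A) = ∫_A f(x) dx` with density `f`. -/
noncomputable def law {d : ℕ} (f : E d → ℝ) : MeasureTheory.Measure (E d) :=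
  MeasureTheory.volume.withDensity fun x => ENNReal.ofReal (f x)

/-- `supp(f) = {x : f(x) > 0}` (no closure is taken). -/
def supp {d : ℕ} (f : E d → ℝ) : Set (E d) := {x | 0 < f x}

/-- The Kullback-Leibler divergence `∫ f log (f / g)`, with values in `[0, ∞]`, of the
probability measures with densities `f` and `g`. -/
noncomputable def KL {d : ℕ} (f g : E d → ℝ) : ℝ≥0∞ :=
  InformationTheory.klDiv (law f) (law g)

/-- The Gaussian density
`(2π)^{-d/2} |Σ|^{-1/2} exp (-(x - μ)ᵀ Σ⁻¹ (x - μ) / 2)`. -/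
noncomputable def gaussianDensity {d : ℕ} (μ : E d) (S : Matrix (Fin d) (Fin d) ℝ)
    (x : E d) : ℝ :=
  (2 * Real.pi) ^ (-(d : ℝ) / 2) * S.det ^ (-(1 / 2) : ℝ) *
    Real.exp (-(1 / 2) * ((x - μ).ofLp ⬝ᵥ (S⁻¹ *ᵥ (x - μ).ofLp)))

/-- The class of all finite Gaussian mixture densities on `ℝ^d`. -/
def mixtures (d : ℕ) : Set (E d → ℝ) :=
  {g | ∃ (m : ℕ) (w : Fin m → ℝ) (μ : Fin m → E d) (S : Fin m → Matrix (Fin d) (Fin d) ℝ),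
    (∀ j, 0 ≤ w j) ∧ ∑ j, w j = 1 ∧ (∀ j, (S j).PosDef) ∧
      g = fun x => ∑ j, w j * gaussianDensity (μ j) (S j) x}

/-- The closed axis-aligned cube with lower corner `a` and side length `s`. -/
def closedCube {d : ℕ} (a : E d) (s : ℝ) : Set (E d) :=
  {x | ∀ i, x i ∈ Set.Icc (a i) (a i + s)}

/-- `B` contains a closed axis-aligned cube of side length `s` having `y` as a vertex. -/
def ContainsCubeAt {d : ℕ} (B : Set (E d)) (s : ℝ) (y : E d) : Prop :=
  ∃ a : E d, (∀ i, y i = a i ∨ y i = a i + s) ∧ closedCube a s ⊆ B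

/-- An axis-aligned cube of side length `h` in which each side may or may not contain
each of its endpoints, as is needed for disjoint unions. -/
def IsPartitionCube {d : ℕ} (h : ℝ) (B : Set (E d)) : Prop :=
  ∃ (a : E d) (I : Fin d → Set ℝ),
    (∀ i, I i = Set.Icc (a i) (a i + h) ∨ I i = Set.Ico (a i) (a i + h) ∨
      I i = Set.Ioc (a i) (a i + h) ∨ I i = Set.Ioo (a i) (a i + h)) ∧
    B = {x | ∀ i, x i ∈ I i}

/-- Adjacent cubes with common side length `h`: pairwise disjoint interiors, and the union
of the closures is connected. -/
structure AdjacentCubes {d m : ℕ} (h : ℝ) (B : Fin m → Set (E d)) : Prop where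
  cube : ∀ j, IsPartitionCube h (B j)
  disjoint_interior : Pairwise fun i j => Disjoint (interior (B i)) (interior (B j))
  connected : IsConnected (⋃ j, closure (B j))

/-- `Y = A 0 ⊔ A 1 ⊔ ⋯ ⊔ A m`, where `A 1, …, A m` are adjacent cubes with a common side
length and `A 0` is the remainder. -/
structure IsCubePartition {d m : ℕ} (Y : Set (E d)) (A : Fin (m + 1) → Set (E d)) : Prop where
  disjoint : Pairwise fun i j => Disjoint (A i) (A j)
  iUnion_eq : ⋃ j, A j = Y
  adjacent : ∃ h : ℝ, 0 < h ∧ AdjacentCubes h fun j : Fin m => A j.succ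

/-- `D(y) = log (f(y) / inf_{z ∈ C(y)} f(z))`, equal to `⊤` if `f(y) > 0` and the infimum
vanishes. -/
noncomputable def logOsc {d : ℕ} (f : E d → ℝ) (C : E d → Set (E d)) (y : E d) : EReal :=
  ENNReal.log (ENNReal.ofReal (f y) / ⨅ z ∈ C y, ENNReal.ofReal (f z))

/-- `D(y) ≥ 0` wherever it is used, so that passing to `(D y).toENNReal` loses nothing. -/
theorem logOsc_nonneg {d : ℕ} {f : E d → ℝ} {C : E d → Set (E d)} {y : E d}
    (hy : y ∈ supp f) (hC : y ∈ C y) : 0 ≤ logOsc f C y := by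
  have h1 : (⨅ z ∈ C y, ENNReal.ofReal (f z)) ≤ ENNReal.ofReal (f y) := iInf₂_le y hC
  have h2 : ENNReal.ofReal (f y) ≠ 0 := by simpa [supp] using hy
  rw [logOsc, ← ENNReal.log_one]
  refine ENNReal.log_monotone ?_
  rw [ENNReal.le_div_iff_mul_le (Or.inr h2) (Or.inr ENNReal.ofReal_ne_top)]
  simpa using h1

/-- The density `f` satisfies the fixed-scale support-aware condition with witness scale `r`,
comparison cubes `C y` and partitions `A m` of `supp f`, `m ≥ 1`. -/
structure IsFSSAWith {d : ℕ} (f : E d → ℝ) (r : ℝ) (C : E d → Set (E d))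
    (A : (m : ℕ) → Fin (m + 1) → Set (E d)) : Prop where
  partition : ∀ m, 1 ≤ m → IsCubePartition (supp f) (A m)
  continuous : ∀ᵐ y ∂(law f), y ∈ supp f → ContinuousWithinAt f (supp f) y
  scale_pos : 0 < r
  cube : ∀ y ∈ supp f, (∃ a, C y = closedCube a r) ∧ y ∈ C y
  measurable : Measurable fun y : supp f => logOsc f C y
  integral_lt_top : ∫⁻ y in supp f, (logOsc f C y).toENNReal ∂(law f) < ⊤
  thick : ∃ M : ℕ, ∀ m, 1 ≤ m → M ≤ m →
    (∀ y ∈ A m 0, ContainsCubeAt (C y ∩ A m 0) (r / 2) y) ∧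
    (∀ y ∈ supp f \ A m 0, ContainsCubeAt (C y ∩ (supp f \ A m 0)) (r / 2) y)

/-- The normalized restriction `f 1_Y / F(Y)`. -/
noncomputable def normRestrict {d : ℕ} (f : E d → ℝ) (Y : Set (E d)) (x : E d) : ℝ :=
  Y.indicator f x / (law f Y).toReal

/-- The countable-scale support-aware class. In both series the terms with `F(Y ℓ) = 0`
vanish. -/
def IsCSSA {d : ℕ} (f : E d → ℝ) : Prop :=
  ∃ Y : ℕ → Set (E d),
    (∀ l, MeasurableSet (Y l)) ∧ (Pairwise fun k l => Disjoint (Y k) (Y l)) ∧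
    ⋃ l, Y l = supp f ∧
    ∃ (r : ℕ → ℝ) (C : ℕ → E d → Set (E d))
      (A : ℕ → (m : ℕ) → Fin (m + 1) → Set (E d)),
      (∀ l, 0 < law f (Y l) → IsFSSAWith (normRestrict f (Y l)) (r l) (C l) (A l)) ∧
      ∑' l, law f (Y l) *
        (∫⁻ y in Y l, (logOsc (normRestrict f (Y l)) (C l) y).toENNReal
          ∂(law (normRestrict f (Y l)))) < ⊤ ∧
      ∑' l, law f (Y l) * ENNReal.ofReal (max (Real.log (1 / r l)) 0) < ⊤

end GMM

/-!
The oscillation and scale hypotheses of the countable-scale class enter only through the positive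
part of the entropy. A probability density has infimum at most `r⁻ᵈ` over a cube of side `r`, so
`log f_ℓ ≤ D_ℓ + d log₊ (1 / r_ℓ)` on `Y_ℓ`, and the two series in the definition of the class give
`∫ f log₊ f < ∞` (`IsCSSA.lintegral_log_ne_top`).

Any density `f` with `∫ f log₊ f < ∞` and finite second moment is approximable in divergence by
finite Gaussian mixtures (`iInf_KL_eq_zero`). Give the density `x ↦ exp (-π ‖x‖²)` a small weight
`ε` in every approximating mixture and weight `1 - ε` to the rest `g`. The positive part of
`log (f / ((1 - ε) g + ε exp (-π ‖x‖²)))` is then at most `log₊ f - log ε + π ‖x‖²`, which is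
integrable under the law of `f` and independent of `g`. Its integral, `posLogExcess ε f g`, bounds
the divergence (`KL_le_lintegral_log`) and, by dominated convergence, is continuous in `g` along
sequences converging almost everywhere (`tendsto_posLogExcess`). Every density is reached from
finite isotropic mixtures by three such limits: finite mixtures converge to Gaussian smoothings,
because a Bochner integral of translates lies in their closed convex hull; Gaussian smoothings of a
continuous density converge to it; and mollifications of `f` converge to `f` almost everywhere. At
`g = f` the functional is at most `-log (1 - ε)`.

Conversely, a Gaussian mixture has a moment `∫ exp (c ‖x‖²) g(x) dx < ∞` for some `c > 0`. By
Young's inequality `a b ≤ a log a - a + e^b`, with `a` the likelihood ratio and `b = c ‖x‖²`, a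
finite divergence from a single mixture already forces a finite second moment
(`lintegral_norm_sq_ne_top_of_KL_ne_top`).
-/

namespace GMM

open MeasureTheory Filter Topology Real

variable {d : ℕ}

/-! ### Laws with a density -/

lemma IsDensity.isProbabilityMeasure_law {f : E d → ℝ} (hf : IsDensity f) :
    IsProbabilityMeasure (law f) :=
  ⟨by rw [law, withDensity_apply _ MeasurableSet.univ, Measure.restrict_univ]
      exact hf.lintegral_eq_one⟩

lemma lintegral_law {f : E d → ℝ} (hf : Measurable f) {φ : E d → ℝ≥0∞} (hφ : Measurable φ) :
    ∫⁻ x, φ x ∂law f = ∫⁻ x, ENNReal.ofReal (f x) * φ x := by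
  rw [law, lintegral_withDensity_eq_lintegral_mul _ hf.ennreal_ofReal hφ]
  rfl

lemma law_absolutelyContinuous (f : E d → ℝ) : law f ≪ volume :=
  withDensity_absolutelyContinuous _ _

lemma IsDensity.ae_pos {f : E d → ℝ} (hf : IsDensity f) : ∀ᵐ x ∂law f, 0 < f x := by
  rw [law, ae_withDensity_iff hf.measurable.ennreal_ofReal]
  exact Eventually.of_forall fun x hx => by simpa using hx

lemma IsDensity.integrable {f : E d → ℝ} (hf : IsDensity f) : Integrable f := by
  refine (lintegral_ofReal_ne_top_iff_integrable hf.measurable.aestronglyMeasurable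
    (Eventually.of_forall hf.nonneg)).1 ?_
  simp [hf.lintegral_eq_one]

lemma IsDensity.integral_eq_one {f : E d → ℝ} (hf : IsDensity f) : ∫ x, f x = 1 := by
  rw [integral_eq_lintegral_of_nonneg_ae (Eventually.of_forall hf.nonneg)
    hf.measurable.aestronglyMeasurable, hf.lintegral_eq_one, ENNReal.toReal_one]

lemma isDensity_of_integral_eq_one {f : E d → ℝ} (hm : Measurable f) (h0 : ∀ x, 0 ≤ f x)
    (h1 : ∫ x, f x = 1) : IsDensity f := by
  refine ⟨hm, h0, ?_⟩
  have hi : Integrable f := by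
    by_contra h
    rw [integral_undef h] at h1
    exact zero_ne_one h1
  rw [← ofReal_integral_eq_lintegral_ofReal hi (Eventually.of_forall h0), h1, ENNReal.ofReal_one]

lemma convex_isDensity : Convex ℝ {f : E d → ℝ | IsDensity f} := by
  intro f hf g hg a b ha hb hab
  refine isDensity_of_integral_eq_one ?_ ?_ ?_
  · exact (hf.measurable.const_smul a).add (hg.measurable.const_smul b)
  · intro x
    have := hf.nonneg x
    have := hg.nonneg x
    simp only [Pi.add_apply, Pi.smul_apply, smul_eq_mul]
    positivity
  · have := integral_add (hf.integrable.smul a) (hg.integrable.smul b)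
    simp only [Pi.smul_apply, integral_smul, hf.integral_eq_one, hg.integral_eq_one] at this
    simpa [hab] using this

/-- The density of a law with respect to another one is the ratio of the densities. -/
lemma law_eq_withDensity_div {f g : E d → ℝ} (hf : IsDensity f) (hg : IsDensity g)
    (hpos : ∀ x, 0 < g x) :
    law f = (law g).withDensity fun x => ENNReal.ofReal (f x / g x) := by
  have hm : Measurable fun x => ENNReal.ofReal (f x / g x) :=
    (hf.measurable.div hg.measurable).ennreal_ofReal
  rw [law, law, ← withDensity_mul _ hg.measurable.ennreal_ofReal hm]
  congr 1
  ext x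
  simp only [Pi.mul_apply]
  rw [← ENNReal.ofReal_mul (hg.nonneg x), mul_div_cancel₀ _ (hpos x).ne']

/-- Discarding the negative part of `log (f / g)` can only increase the divergence. Unlike the
integrand of the divergence, the positive part is easily dominated. -/
lemma KL_le_lintegral_log {f g : E d → ℝ} (hf : IsDensity f) (hg : IsDensity g)
    (hpos : ∀ x, 0 < g x) :
    KL f g ≤ ∫⁻ x, ENNReal.ofReal (log (f x / g x)) ∂law f := by
  have := hf.isProbabilityMeasure_law
  have := hg.isProbabilityMeasure_law
  set ρ : E d → ℝ := fun x => f x / g x with hρ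
  have hρm : Measurable ρ := hf.measurable.div hg.measurable
  have hρ0 : ∀ x, 0 ≤ ρ x := fun x => div_nonneg (hf.nonneg x) (hg.nonneg x)
  have hlaw : law f = (law g).withDensity fun x => ENNReal.ofReal (ρ x) :=
    law_eq_withDensity_div hf hg hpos
  have hac : law f ≪ law g := hlaw ▸ withDensity_absolutelyContinuous _ _
  have hrn : (law f).rnDeriv (law g) =ᵐ[law g] fun x => ENNReal.ofReal (ρ x) := by
    rw [hlaw]
    exact Measure.rnDeriv_withDensity _ hρm.ennreal_ofReal
  have hone : ∫⁻ x, ENNReal.ofReal (ρ x) ∂law g = 1 := by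
    have h : law f Set.univ = 1 := measure_univ
    rwa [hlaw, withDensity_apply _ MeasurableSet.univ, Measure.restrict_univ] at h
  rw [KL, InformationTheory.klDiv_eq_lintegral_klFun_of_ac hac]
  have h1 : ∫⁻ x, ENNReal.ofReal (InformationTheory.klFun ((law f).rnDeriv (law g) x).toReal)
      ∂law g = ∫⁻ x, ENNReal.ofReal (InformationTheory.klFun (ρ x)) ∂law g := by
    refine lintegral_congr_ae ?_
    filter_upwards [hrn] with x hx
    rw [hx, ENNReal.toReal_ofReal (hρ0 x)]
  have h2 : ∫⁻ x, ENNReal.ofReal (log (ρ x)) ∂law f =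
      ∫⁻ x, ENNReal.ofReal (ρ x) * ENNReal.ofReal (log (ρ x)) ∂law g := by
    have hm : Measurable fun x => ENNReal.ofReal (log (ρ x)) := hρm.log.ennreal_ofReal
    conv_lhs => rw [hlaw]
    rw [lintegral_withDensity_eq_lintegral_mul _ hρm.ennreal_ofReal hm]
    rfl
  rw [h1, h2]
  -- The integrand of the divergence is `ρ log ρ + 1 - ρ`, and `ρ` and `1` both have integral `1`:
  -- adding `1` on both sides removes the correction without leaving the nonnegative numbers.
  refine (ENNReal.add_le_add_iff_right ENNReal.one_ne_top).1 ?_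
  calc _ = ∫⁻ x, (ENNReal.ofReal (InformationTheory.klFun (ρ x)) + ENNReal.ofReal (ρ x))
        ∂law g := by rw [lintegral_add_right _ hρm.ennreal_ofReal, hone]
    _ ≤ ∫⁻ x, (ENNReal.ofReal (ρ x) * ENNReal.ofReal (log (ρ x)) + 1) ∂law g := by
        refine lintegral_mono fun x => ?_
        rw [← ENNReal.ofReal_add (InformationTheory.klFun_nonneg (hρ0 x)) (hρ0 x),
          ← ENNReal.ofReal_mul (hρ0 x), InformationTheory.klFun]
        calc ENNReal.ofReal (ρ x * log (ρ x) + 1 - ρ x + ρ x)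
            = ENNReal.ofReal (ρ x * log (ρ x) + 1) := by congr 1; ring
          _ ≤ _ := by simpa using ENNReal.ofReal_add_le (p := ρ x * log (ρ x)) (q := 1)
    _ = _ := by rw [lintegral_add_right _ measurable_const]; simp

/-! ### Isotropic Gaussian kernels -/

/-- The centred isotropic Gaussian density with covariance matrix `(2π²c)⁻¹ • 1`. The precision
`c` is normalized so that `c → ∞` gives the approximate identity of the Fourier inversion
theorem. -/
noncomputable def gaussKernel (c : ℝ) (v : E d) : ℝ :=
  (π * c) ^ ((d : ℝ) / 2) * exp (-(π ^ 2 * c) * ‖v‖ ^ 2)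

lemma gaussKernel_pos {c : ℝ} (hc : 0 < c) (v : E d) : 0 < gaussKernel c v := by
  unfold gaussKernel
  positivity

lemma continuous_gaussKernel (c : ℝ) : Continuous (gaussKernel c : E d → ℝ) := by
  unfold gaussKernel
  fun_prop

lemma gaussKernel_inv_pi (v : E d) : gaussKernel π⁻¹ v = exp (-π * ‖v‖ ^ 2) := by
  have : π ^ 2 * π⁻¹ = π := by field_simp
  rw [gaussKernel, mul_inv_cancel₀ pi_ne_zero, one_rpow, one_mul, this]

lemma integral_gaussKernel {c : ℝ} (hc : 0 < c) : ∫ v : E d, gaussKernel c v = 1 := by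
  unfold gaussKernel
  rw [integral_const_mul, GaussianFourier.integral_rexp_neg_mul_sq_norm (by positivity),
    finrank_euclideanSpace_fin, ← mul_rpow (by positivity) (by positivity)]
  have : π * c * (π / (π ^ 2 * c)) = 1 := by field_simp
  rw [this, one_rpow]

lemma isDensity_gaussKernel_sub {c : ℝ} (hc : 0 < c) (y : E d) :
    IsDensity fun x => gaussKernel c (x - y) := by
  refine isDensity_of_integral_eq_one ?_ (fun x => (gaussKernel_pos hc _).le) ?_
  · exact ((continuous_gaussKernel c).comp (by fun_prop)).measurable
  · rw [integral_sub_right_eq_self (gaussKernel c), integral_gaussKernel hc]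

lemma gaussianDensity_isotropic {c : ℝ} (hc : 0 < c) (y x : E d) :
    gaussianDensity y ((2 * π ^ 2 * c)⁻¹ • (1 : Matrix (Fin d) (Fin d) ℝ)) x =
      gaussKernel c (x - y) := by
  have hs : 0 < 2 * π ^ 2 * c := by positivity
  have hinv : ((2 * π ^ 2 * c)⁻¹ • (1 : Matrix (Fin d) (Fin d) ℝ))⁻¹ =
      (2 * π ^ 2 * c) • 1 := by
    refine Matrix.inv_eq_left_inv ?_
    rw [smul_mul_smul_comm, mul_inv_cancel₀ hs.ne', one_mul, one_smul]
  have hdet : ((2 * π ^ 2 * c)⁻¹ • (1 : Matrix (Fin d) (Fin d) ℝ)).det =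
      (2 * π ^ 2 * c) ^ (-(d : ℝ)) := by
    rw [Matrix.det_smul, Matrix.det_one, mul_one, Fintype.card_fin, rpow_neg hs.le,
      rpow_natCast, inv_pow]
  rw [gaussianDensity, hinv, hdet, ← rpow_mul hs.le, gaussKernel]
  congr 1
  · have h1 : -(d : ℝ) * -(1 / 2) = d / 2 := by ring
    have h2 : -(d : ℝ) / 2 = -(d / 2) := by ring
    rw [h1, h2, rpow_neg (by positivity), ← inv_rpow (by positivity),
      ← mul_rpow (by positivity) hs.le]
    congr 1
    field_simp
  · rw [Matrix.smul_mulVec, Matrix.one_mulVec, dotProduct_smul, EuclideanSpace.real_norm_sq_eq]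
    congr 1
    simp only [dotProduct, smul_eq_mul, ← pow_two]
    ring

/-- The Gaussian kernels of precision `c > 0` and arbitrary centre. -/
def isotropicGaussians (d : ℕ) : Set (E d → ℝ) :=
  {g | ∃ c : ℝ, 0 < c ∧ ∃ y : E d, g = fun x => gaussKernel c (x - y)}

lemma isDensity_of_mem_convexHull {g : E d → ℝ}
    (hg : g ∈ convexHull ℝ (isotropicGaussians d)) : IsDensity g := by
  refine convexHull_min ?_ convex_isDensity hg
  rintro _ ⟨c, hc, y, rfl⟩
  exact isDensity_gaussKernel_sub hc y

lemma convexHull_subset_mixtures : convexHull ℝ (isotropicGaussians d) ⊆ mixtures d := by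
  intro g hg
  obtain ⟨ι, _, w, z, hw0, hw1, hz, rfl⟩ := mem_convexHull_iff_exists_fintype.1 hg
  choose c hc y hy using hz
  let e := Fintype.equivFin ι
  refine ⟨Fintype.card ι, fun j => w (e.symm j), fun j => y (e.symm j),
    fun j => (2 * π ^ 2 * c (e.symm j))⁻¹ • 1, fun j => hw0 _, ?_, fun j => ?_, ?_⟩
  · rw [← hw1, e.symm.sum_comp w]
  · have := hc (e.symm j)
    exact Matrix.PosDef.one.smul (by positivity)
  · ext x
    rw [e.symm.sum_comp fun i => w i * gaussianDensity (y i) ((2 * π ^ 2 * c i)⁻¹ • 1) x,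
      Finset.sum_apply]
    refine Finset.sum_congr rfl fun i _ => ?_
    rw [gaussianDensity_isotropic (hc i), hy i]
    rfl

/-! ### Pointwise approximation by finite Gaussian mixtures -/

lemma gaussKernel_le {c : ℝ} (hc : 0 < c) (v : E d) :
    gaussKernel c v ≤ (π * c) ^ ((d : ℝ) / 2) := by
  have h1 : exp (-(π ^ 2 * c) * ‖v‖ ^ 2) ≤ 1 := by
    rw [exp_le_one_iff, neg_mul, neg_nonpos]
    positivity
  exact mul_le_of_le_one_right (by positivity) h1

lemma uniformContinuous_gaussKernel {c : ℝ} (hc : 0 < c) :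
    UniformContinuous (gaussKernel c : E d → ℝ) := by
  refine (continuous_gaussKernel c).uniformContinuous_of_tendsto_cocompact (x := 0) ?_
  have h1 : Tendsto (fun v : E d => π ^ 2 * c * ‖v‖ ^ 2) (cocompact (E d)) atTop :=
    ((tendsto_pow_atTop two_ne_zero).comp tendsto_norm_cocompact_atTop).const_mul_atTop
      (by positivity)
  have h2 := (tendsto_exp_neg_atTop_nhds_zero.comp h1).const_mul ((π * c) ^ ((d : ℝ) / 2))
  rw [mul_zero] at h2
  refine h2.congr fun v => ?_
  simp [gaussKernel]

/-- The translate of a Gaussian kernel, as an element of the Banach space of bounded continuous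
functions. -/
noncomputable def gaussTranslate {c : ℝ} (hc : 0 < c) (y : E d) :
    BoundedContinuousFunction (E d) ℝ :=
  BoundedContinuousFunction.ofNormedAddCommGroup (fun x => gaussKernel c (x - y))
    ((continuous_gaussKernel c).comp (by fun_prop)) ((π * c) ^ ((d : ℝ) / 2)) fun x => by
      rw [norm_eq_abs, abs_of_pos (gaussKernel_pos hc _)]
      exact gaussKernel_le hc _

lemma continuous_gaussTranslate {c : ℝ} (hc : 0 < c) :
    Continuous (gaussTranslate hc : E d → BoundedContinuousFunction (E d) ℝ) := by
  refine Metric.continuous_iff.2 fun y ε hε => ?_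
  obtain ⟨δ, hδ, h⟩ :=
    Metric.uniformContinuous_iff.1 (uniformContinuous_gaussKernel (d := d) hc) (ε / 2)
      (half_pos hε)
  refine ⟨δ, hδ, fun z hz => ?_⟩
  refine lt_of_le_of_lt ((BoundedContinuousFunction.dist_le (half_pos hε).le).2 fun x => ?_)
    (half_lt_self hε)
  refine (h ?_).le
  rwa [dist_sub_left]

/-- A Gaussian smoothing `x ↦ ∫ γ_c(x - y) u(y) dy` is the average of the translates of `γ_c`
under the law of `u`; as a Bochner integral in the space of bounded continuous functions it lies
in their closed convex hull. -/
lemma exists_tendsto_gaussian_smoothing {u : E d → ℝ} (hu : IsDensity u) {c : ℝ} (hc : 0 < c) :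
    ∃ g : ℕ → E d → ℝ, (∀ n, g n ∈ convexHull ℝ (isotropicGaussians d)) ∧
      ∀ x, Tendsto (fun n => g n x) atTop (𝓝 (∫ y, gaussKernel c (x - y) * u y)) := by
  have := hu.isProbabilityMeasure_law
  have hint : Integrable (gaussTranslate hc) (law u) := by
    refine Integrable.of_bound (continuous_gaussTranslate hc).aestronglyMeasurable
      ((π * c) ^ ((d : ℝ) / 2)) (Eventually.of_forall fun y => ?_)
    refine (BoundedContinuousFunction.norm_le (by positivity)).2 fun x => ?_
    change ‖gaussKernel c (x - y)‖ ≤ _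
    rw [norm_eq_abs, abs_of_pos (gaussKernel_pos hc _)]
    exact gaussKernel_le hc _
  have hmem := ((convex_convexHull ℝ (Set.range (gaussTranslate (d := d) hc))).closure).integral_mem
    isClosed_closure (Eventually.of_forall fun y =>
      subset_closure (subset_convexHull ℝ _ (Set.mem_range_self y))) hint
  obtain ⟨p, hp, hlim⟩ := mem_closure_iff_seq_limit.1 hmem
  refine ⟨fun n => p n, fun n => ?_, fun x => ?_⟩
  · let T : BoundedContinuousFunction (E d) ℝ →ₗ[ℝ] (E d → ℝ) :=
      { toFun := fun p => p, map_add' := fun _ _ => rfl, map_smul' := fun _ _ => rfl }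
    have h1 : T (p n) ∈ T '' convexHull ℝ (Set.range (gaussTranslate hc)) := ⟨_, hp n, rfl⟩
    rw [T.image_convexHull] at h1
    refine convexHull_mono ?_ h1
    rintro _ ⟨_, ⟨y, rfl⟩, rfl⟩
    exact ⟨c, hc, y, rfl⟩
  · have h1 := ((BoundedContinuousFunction.evalCLM ℝ x).continuous.tendsto _).comp hlim
    rw [← ContinuousLinearMap.integral_comp_comm _ hint] at h1
    have h2 : ∫ y, BoundedContinuousFunction.evalCLM ℝ x (gaussTranslate hc y) ∂law u =
        ∫ y, gaussKernel c (x - y) * u y := by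
      rw [law, integral_withDensity_eq_integral_toReal_smul hu.measurable.ennreal_ofReal
        (Eventually.of_forall fun _ => ENNReal.ofReal_lt_top)]
      refine integral_congr_ae (Eventually.of_forall fun y => ?_)
      change (ENNReal.ofReal (u y)).toReal • gaussKernel c (x - y) = _
      rw [ENNReal.toReal_ofReal (hu.nonneg y), smul_eq_mul, mul_comm]
    rw [h2] at h1
    exact h1

lemma tendsto_gaussian_smoothing {u : E d → ℝ} (hu : Integrable u) (hc : Continuous u) (x : E d) :
    Tendsto (fun c => ∫ y, gaussKernel c (x - y) * u y) atTop (𝓝 (u x)) := by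
  -- The approximate identity of Fourier inversion is stated for complex functions.
  have h := tendsto_integral_gaussian_smul' (hu.ofReal (𝕜 := ℂ)) (v := x)
    (Complex.continuous_ofReal.comp hc).continuousAt
  have h' := (Complex.continuous_re.tendsto _).comp h
  refine Tendsto.congr' ?_ h'
  filter_upwards [eventually_gt_atTop 0] with c hc
  have h1 : ∀ y : E d, (((π * c : ℂ) ^ (Module.finrank ℝ (E d) / 2 : ℂ) *
      Complex.exp (-π ^ 2 * c * ‖x - y‖ ^ 2)) • ((u y : ℝ) : ℂ)) =
      ((gaussKernel c (x - y) * u y : ℝ) : ℂ) := by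
    intro y
    rw [finrank_euclideanSpace_fin, gaussKernel]
    push_cast
    rw [Complex.ofReal_cpow (by positivity)]
    push_cast
    simp
  simp only [Function.comp_apply]
  erw [integral_congr_ae (Eventually.of_forall h1)]
  rw [integral_complex_ofReal, Complex.ofReal_re]

/-- Mollification by smooth bump functions, with almost everywhere convergence by the Lebesgue
differentiation theorem. -/
lemma exists_continuous_isDensity_tendsto {f : E d → ℝ} (hf : IsDensity f) :
    ∃ u : ℕ → E d → ℝ, (∀ n, IsDensity (u n) ∧ Continuous (u n)) ∧
      ∀ᵐ x, Tendsto (fun n => u n x) atTop (𝓝 (f x)) := by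
  have hpos : ∀ n : ℕ, 0 < 1 / ((n : ℝ) + 1) := fun n => Nat.one_div_pos_of_nat
  -- Comparable inner and outer radii, as differentiation along the bump functions requires.
  let b : ℕ → ContDiffBump (0 : E d) := fun n =>
    ⟨1 / ((n : ℝ) + 1), 2 * (1 / ((n : ℝ) + 1)), hpos n, by linarith [hpos n]⟩
  refine ⟨fun n => convolution ((b n).normed volume) f (ContinuousLinearMap.lsmul ℝ ℝ) volume,
    fun n => ?_, ?_⟩
  · have hcont := (b n).hasCompactSupport_normed (μ := volume).continuous_convolution_left
      (ContinuousLinearMap.lsmul ℝ ℝ) (b n).continuous_normed hf.integrable.locallyIntegrable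
    refine ⟨isDensity_of_integral_eq_one hcont.measurable (fun x => ?_) ?_, hcont⟩
    · refine integral_nonneg fun t => ?_
      exact mul_nonneg ((b n).nonneg_normed t) (hf.nonneg _)
    · rw [integral_convolution _ (b n).integrable_normed hf.integrable, (b n).integral_normed,
        hf.integral_eq_one]
      simp
  · refine ContDiffBump.ae_convolution_tendsto_right_of_locallyIntegrable (K := 2) ?_ ?_
      hf.integrable.locallyIntegrable
    · have h := (tendsto_one_div_add_atTop_nhds_zero_nat (𝕜 := ℝ)).const_mul (2 : ℝ)
      rwa [mul_zero] at h
    · exact Eventually.of_forall fun n => le_rfl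

/-! ### Approximation in divergence -/

/-- The integral of the positive part of `log (f / g')` under the law of `f`, where `g'` is the
mixture of `g` with weight `1 - ε` and of the Gaussian density `x ↦ exp (-π ‖x‖²)` with weight
`ε`. The second component bounds `g'` from below independently of `g`. -/
noncomputable def posLogExcess (ε : ℝ) (f g : E d → ℝ) : ℝ≥0∞ :=
  ∫⁻ x, ENNReal.ofReal (log (f x / ((1 - ε) * g x + ε * gaussKernel π⁻¹ x))) ∂law f

/-- The bound does not involve `t`; it is the dominating function for `posLogExcess`. -/
lemma log_div_le {ε a t : ℝ} (hε : 0 < ε) (ha : 0 < a) (ht : 0 ≤ t) (hε1 : ε ≤ 1) (v : E d) :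
    log (a / ((1 - ε) * t + ε * gaussKernel π⁻¹ v)) ≤ log a + -log ε + π * ‖v‖ ^ 2 := by
  have h0 : 0 < ε * gaussKernel π⁻¹ v := mul_pos hε (gaussKernel_pos (by positivity) v)
  have h1 : ε * gaussKernel π⁻¹ v ≤ (1 - ε) * t + ε * gaussKernel π⁻¹ v :=
    le_add_of_nonneg_left (mul_nonneg (by linarith) ht)
  rw [log_div ha.ne' (h0.trans_le h1).ne']
  have h2 := log_le_log h0 h1
  rw [log_mul hε.ne' (gaussKernel_pos (by positivity) v).ne', gaussKernel_inv_pi, log_exp] at h2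
  rw [gaussKernel_inv_pi]
  linarith

lemma tendsto_posLogExcess {f : E d → ℝ} (hf : IsDensity f)
    (hent : ∫⁻ x, ENNReal.ofReal (log (f x)) ∂law f ≠ ⊤)
    (hmom : ∫⁻ x, ENNReal.ofReal (‖x‖ ^ 2) ∂law f ≠ ⊤) {ε : ℝ} (hε : 0 < ε) (hε1 : ε ≤ 1)
    {g : ℕ → E d → ℝ} {h : E d → ℝ} (hg : ∀ n, Measurable (g n)) (hg0 : ∀ n x, 0 ≤ g n x)
    (hh : ∀ x, 0 ≤ h x)
    (hlim : ∀ᵐ x, Tendsto (fun n => g n x) atTop (𝓝 (h x))) :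
    Tendsto (fun n => posLogExcess ε f (g n)) atTop (𝓝 (posLogExcess ε f h)) := by
  have := hf.isProbabilityMeasure_law
  have hφ : Measurable (gaussKernel π⁻¹ : E d → ℝ) := (continuous_gaussKernel _).measurable
  have hm1 : Measurable fun x : E d => ENNReal.ofReal (log (f x)) :=
    hf.measurable.log.ennreal_ofReal
  have hm2 : Measurable fun x : E d => ENNReal.ofReal (‖x‖ ^ 2) :=
    (measurable_norm.pow_const 2).ennreal_ofReal
  refine tendsto_lintegral_of_dominated_convergence
    (fun x => ENNReal.ofReal (log (f x)) + ENNReal.ofReal (-log ε) +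
      ENNReal.ofReal π * ENNReal.ofReal (‖x‖ ^ 2)) (fun n => ?_) (fun n => ?_) ?_ ?_
  · exact (hf.measurable.div (((hg n).const_mul _).add
      (hφ.const_mul _))).log.ennreal_ofReal
  · filter_upwards [hf.ae_pos] with x hx
    refine (ENNReal.ofReal_le_ofReal (log_div_le hε hx (hg0 n x) hε1 x)).trans ?_
    rw [← ENNReal.ofReal_mul pi_pos.le]
    exact ENNReal.ofReal_add_le.trans (add_le_add_left ENNReal.ofReal_add_le _)
  · rw [lintegral_add_left (hm1.add_const _), lintegral_add_left hm1,
      lintegral_const_mul _ hm2, lintegral_const, measure_univ, mul_one]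
    exact ENNReal.add_ne_top.2 ⟨ENNReal.add_ne_top.2 ⟨hent, ENNReal.ofReal_ne_top⟩,
      ENNReal.mul_ne_top ENNReal.ofReal_ne_top hmom⟩
  · filter_upwards [hf.ae_pos, law_absolutelyContinuous f hlim] with x hx hl
    have h0 : 0 < (1 - ε) * h x + ε * gaussKernel π⁻¹ x :=
      add_pos_of_nonneg_of_pos (mul_nonneg (by linarith) (hh x))
        (mul_pos hε (gaussKernel_pos (by positivity) x))
    refine ENNReal.tendsto_ofReal ((Tendsto.log ?_ (div_pos hx h0).ne'))
    exact tendsto_const_nhds.div ((hl.const_mul _).add_const _) h0.ne'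

lemma iInf_KL_le_posLogExcess {f g : E d → ℝ} (hf : IsDensity f)
    (hg : g ∈ convexHull ℝ (isotropicGaussians d)) {ε : ℝ} (hε : 0 < ε) (hε1 : ε ≤ 1) :
    ⨅ g ∈ mixtures d, KL f g ≤ posLogExcess ε f g := by
  have hφ : (gaussKernel π⁻¹ : E d → ℝ) ∈ convexHull ℝ (isotropicGaussians d) :=
    subset_convexHull ℝ _ ⟨π⁻¹, by positivity, 0, by simp⟩
  have hmem : (1 - ε) • g + ε • gaussKernel π⁻¹ ∈ convexHull ℝ (isotropicGaussians d) :=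
    convex_convexHull ℝ _ hg hφ (by linarith) hε.le (by ring)
  refine (iInf₂_le _ (convexHull_subset_mixtures hmem)).trans ?_
  refine KL_le_lintegral_log hf (isDensity_of_mem_convexHull hmem) fun x => ?_
  exact add_pos_of_nonneg_of_pos
    (mul_nonneg (by linarith) ((isDensity_of_mem_convexHull hg).nonneg x))
    (mul_pos hε (gaussKernel_pos (by positivity) x))

/-- Finite positive entropy part and finite second moment suffice for approximation in
divergence: the bound by `posLogExcess` passes from finite mixtures to Gaussian smoothings of
continuous densities, then to continuous densities, then to `f` itself, where the mixing weight
`1 - ε` alone bounds the ratio. -/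
lemma iInf_KL_eq_zero {f : E d → ℝ} (hf : IsDensity f)
    (hent : ∫⁻ x, ENNReal.ofReal (log (f x)) ∂law f ≠ ⊤)
    (hmom : ∫⁻ x, ENNReal.ofReal (‖x‖ ^ 2) ∂law f ≠ ⊤) :
    ⨅ g ∈ mixtures d, KL f g = 0 := by
  have := hf.isProbabilityMeasure_law
  have key : ∀ ε ∈ Set.Ioo (0 : ℝ) 1,
      ⨅ g ∈ mixtures d, KL f g ≤ ENNReal.ofReal (-log (1 - ε)) := by
    rintro ε ⟨hε, hε1⟩
    have hcont : ∀ u : E d → ℝ, IsDensity u → Continuous u →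
        ⨅ g ∈ mixtures d, KL f g ≤ posLogExcess ε f u := by
      intro u hu huc
      let s : ℕ → E d → ℝ := fun n x => ∫ y, gaussKernel (n + 1) (x - y) * u y
      have hc : ∀ n : ℕ, (0 : ℝ) < n + 1 := fun n => by positivity
      have hs0 : ∀ n x, 0 ≤ s n x := fun n x =>
        integral_nonneg fun y => mul_nonneg (gaussKernel_pos (hc n) _).le (hu.nonneg y)
      choose g hg hlim using fun n => exists_tendsto_gaussian_smoothing hu (hc n)
      have hgd : ∀ n k, IsDensity (g n k) := fun n k => isDensity_of_mem_convexHull (hg n k)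
      have hs : ∀ n, Measurable (s n) := fun n =>
        measurable_of_tendsto_metrizable (fun k => (hgd n k).measurable)
          (tendsto_pi_nhds.2 (hlim n))
      have hle : ∀ n, ⨅ g ∈ mixtures d, KL f g ≤ posLogExcess ε f (s n) := fun n =>
        ge_of_tendsto (tendsto_posLogExcess hf hent hmom hε hε1.le
          (fun k => (hgd n k).measurable) (fun k => (hgd n k).nonneg) (hs0 n)
          (Eventually.of_forall (hlim n)))
          (Eventually.of_forall fun k => iInf_KL_le_posLogExcess hf (hg n k) hε hε1.le)
      have hsu : ∀ x, Tendsto (fun n => s n x) atTop (𝓝 (u x)) := fun x =>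
        (tendsto_gaussian_smoothing hu.integrable huc x).comp
          (tendsto_atTop_add_const_right _ 1 tendsto_natCast_atTop_atTop)
      exact ge_of_tendsto (tendsto_posLogExcess hf hent hmom hε hε1.le hs hs0 hu.nonneg
        (Eventually.of_forall hsu)) (Eventually.of_forall hle)
    obtain ⟨u, hu, hlim⟩ := exists_continuous_isDensity_tendsto hf
    have hle : ⨅ g ∈ mixtures d, KL f g ≤ posLogExcess ε f f :=
      ge_of_tendsto (tendsto_posLogExcess hf hent hmom hε hε1.le (fun n => (hu n).1.measurable)
        (fun n => (hu n).1.nonneg) hf.nonneg hlim)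
        (Eventually.of_forall fun n => hcont _ (hu n).1 (hu n).2)
    refine hle.trans ?_
    calc posLogExcess ε f f ≤ ∫⁻ _, ENNReal.ofReal (-log (1 - ε)) ∂law f := by
          refine lintegral_mono_ae ?_
          filter_upwards [hf.ae_pos] with x hx
          refine ENNReal.ofReal_le_ofReal ?_
          have h1 : 0 < (1 - ε) * f x := mul_pos (by linarith) hx
          have h2 : (1 - ε) * f x ≤ (1 - ε) * f x + ε * gaussKernel π⁻¹ x :=
            le_add_of_nonneg_right (mul_pos hε (gaussKernel_pos (by positivity) x)).le
          have h3 := log_le_log h1 h2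
          rw [log_mul (by linarith) hx.ne'] at h3
          rw [log_div hx.ne' (h1.trans_le h2).ne']
          linarith
      _ = _ := by simp
  have hlim : Tendsto (fun ε : ℝ => ENNReal.ofReal (-log (1 - ε))) (𝓝[>] 0) (𝓝 0) := by
    have h : ContinuousAt (fun ε : ℝ => ENNReal.ofReal (-log (1 - ε))) 0 := by
      refine ENNReal.continuous_ofReal.continuousAt.comp (ContinuousAt.neg (ContinuousAt.log ?_ ?_))
      · fun_prop
      · norm_num
    simpa [ContinuousAt] using h.tendsto.mono_left (nhdsWithin_le_nhds (s := Set.Ioi 0))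
  refine le_antisymm (ge_of_tendsto hlim ?_) zero_le
  filter_upwards [Ioo_mem_nhdsGT (zero_lt_one' ℝ)] with ε hε using key ε hε

/-! ### The positive entropy part of a density in the countable-scale class -/

lemma volume_closedCube (a : E d) {r : ℝ} (hr : 0 ≤ r) :
    volume (closedCube a r) = ENNReal.ofReal (r ^ d) := by
  have h : closedCube a r =
      (WithLp.ofLp : E d → Fin d → ℝ) ⁻¹' Set.univ.pi fun i => Set.Icc (a i) (a i + r) := by
    ext x
    simp only [closedCube, Set.mem_ofPred_eq, Set.mem_preimage, Set.mem_univ_pi]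
  rw [h, (PiLp.volume_preserving_ofLp (Fin d)).measure_preimage
    (MeasurableSet.univ_pi fun i => measurableSet_Icc).nullMeasurableSet, volume_pi_pi]
  simp [Real.volume_Icc, ENNReal.ofReal_pow hr]

/-- A density of total mass at most one has infimum at most `r⁻ᵈ` over a cube of side `r`. -/
lemma iInf_closedCube_mul_le {g : E d → ℝ} (hg : ∫⁻ x, ENNReal.ofReal (g x) ≤ 1) (a : E d) {r : ℝ}
    (hr : 0 ≤ r) :
    (⨅ z ∈ closedCube a r, ENNReal.ofReal (g z)) * ENNReal.ofReal (r ^ d) ≤ 1 := by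
  have hm : MeasurableSet (closedCube a r) := by
    have : closedCube a r = ⋂ i, {x : E d | x i ∈ Set.Icc (a i) (a i + r)} := by
      ext x
      simp [closedCube]
    rw [this]
    refine MeasurableSet.iInter fun i => ?_
    exact (EuclideanSpace.proj (𝕜 := ℝ) i).continuous.measurable measurableSet_Icc
  calc _ = ∫⁻ _ in closedCube a r, ⨅ z ∈ closedCube a r, ENNReal.ofReal (g z) := by
        rw [lintegral_const, Measure.restrict_apply_univ, volume_closedCube a hr]
    _ ≤ ∫⁻ x in closedCube a r, ENNReal.ofReal (g x) :=
        setLIntegral_mono' hm fun x hx => iInf₂_le x hx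
    _ ≤ _ := (setLIntegral_le_lintegral _ _).trans hg

/-- The infimum of `g` over a cube of side `r` is at most `r⁻ᵈ`, so a large value of `g y`
forces a large oscillation, up to the scale correction `d log (1 / r)`. -/
lemma ofReal_log_le_logOsc {g : E d → ℝ} (hg : ∫⁻ x, ENNReal.ofReal (g x) ≤ 1) {C : E d → Set (E d)}
    {a y : E d} {r : ℝ} (hr : 0 < r) (hC : C y = closedCube a r) (hy : 0 < g y) :
    ENNReal.ofReal (log (g y)) ≤
      (logOsc g C y).toENNReal + d * ENNReal.ofReal (max (log (1 / r)) 0) := by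
  have h1 : ENNReal.ofReal (g y * r ^ d) ≤
      ENNReal.ofReal (g y) / ⨅ z ∈ C y, ENNReal.ofReal (g z) := by
    rw [hC, ENNReal.ofReal_mul hy.le, div_eq_mul_inv]
    gcongr
    rw [ENNReal.le_inv_iff_mul_le, mul_comm]
    exact iInf_closedCube_mul_le hg a hr.le
  have h2 : ENNReal.ofReal (log (g y * r ^ d)) ≤ (logOsc g C y).toENNReal := by
    rw [← EReal.real_coe_toENNReal, ← ENNReal.log_ofReal_of_pos (by positivity)]
    exact EReal.toENNReal_le_toENNReal (ENNReal.log_monotone h1)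
  have h3 : log (g y) ≤ log (g y * r ^ d) + d * max (log (1 / r)) 0 := by
    rw [log_mul hy.ne' (by positivity), log_pow]
    have h4 : -log r ≤ max (log (1 / r)) 0 := by
      rw [one_div, log_inv]
      exact le_max_left _ _
    have := mul_le_mul_of_nonneg_left h4 (Nat.cast_nonneg (α := ℝ) d)
    linarith
  calc _ ≤ ENNReal.ofReal (log (g y * r ^ d) + d * max (log (1 / r)) 0) :=
        ENNReal.ofReal_le_ofReal h3
    _ ≤ _ := ENNReal.ofReal_add_le
    _ ≤ _ := by
        rw [ENNReal.ofReal_mul (Nat.cast_nonneg d), ENNReal.ofReal_natCast]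
        gcongr

/-- The law of the normalized restriction is the conditional law given `Y`. -/
lemma law_normRestrict {f : E d → ℝ} (hf : Measurable f) {Y : Set (E d)} (hY : MeasurableSet Y)
    (h0 : 0 < law f Y) (htop : law f Y ≠ ⊤) :
    law f Y • law (normRestrict f Y) = (law f).restrict Y := by
  have hm : Measurable (normRestrict f Y) := (hf.indicator hY).div_const _
  rw [law.eq_def (normRestrict f Y), ← withDensity_smul _ hm.ennreal_ofReal, law.eq_def f,
    restrict_withDensity hY, ← withDensity_indicator hY, ← law.eq_def f]
  congr 1
  ext x
  have hp : 0 < (law f Y).toReal := ENNReal.toReal_pos h0.ne' htop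
  rw [Pi.smul_apply, smul_eq_mul, normRestrict]
  conv_lhs => rw [← ENNReal.ofReal_toReal htop]
  rw [ ← ENNReal.ofReal_mul hp.le, ENNReal.toReal_ofReal hp.le,
    mul_div_cancel₀ _ hp.ne']
  by_cases hx : x ∈ Y <;> simp [hx]

/-- On the piece `Y ℓ` one has `f ≤ f_ℓ`, so the bound of `log f_ℓ` by the oscillation `D_ℓ` and the
scale `r ℓ` applies to `log f`; the two series of the class then bound the total. -/
lemma IsCSSA.lintegral_log_ne_top {f : E d → ℝ} (hf : IsDensity f) (hF : IsCSSA f) :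
    ∫⁻ x, ENNReal.ofReal (log (f x)) ∂law f ≠ ⊤ := by
  have := hf.isProbabilityMeasure_law
  obtain ⟨Y, hYm, hYd, hYU, r, C, A, hW, hD, hr⟩ := hF
  have hmem : ∀ᵐ x ∂law f, x ∈ ⋃ l, Y l := by
    rw [hYU]
    exact hf.ae_pos
  have hle : ∀ l, ∫⁻ x in Y l, ENNReal.ofReal (log (f x)) ∂law f ≤
      law f (Y l) * (∫⁻ y in Y l, (logOsc (normRestrict f (Y l)) (C l) y).toENNReal
        ∂(law (normRestrict f (Y l)))) +
      d * (law f (Y l) * ENNReal.ofReal (max (log (1 / r l)) 0)) := by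
    intro l
    rcases eq_or_ne (law f (Y l)) 0 with h0 | h0
    · rw [setLIntegral_measure_zero _ _ h0]
      exact zero_le
    set p := law f (Y l) with hp
    have hpt : p ≠ ⊤ := measure_ne_top _ _
    have hp0 : 0 < p.toReal := ENNReal.toReal_pos h0 hpt
    have hp1 : p.toReal ≤ 1 := ENNReal.toReal_le_of_le_ofReal zero_le_one (by simpa using prob_le_one)
    have hw := hW l (pos_iff_ne_zero.2 h0)
    have hlaw := law_normRestrict hf.measurable (hYm l) (pos_iff_ne_zero.2 h0) hpt
    rw [← hp] at hlaw
    set g := normRestrict f (Y l) with hg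
    have hgf : ∀ x ∈ Y l, 0 < f x ∧ g x = f x / p.toReal := fun x hx => by
      refine ⟨?_, by simp [hg, normRestrict, hx, hp]⟩
      have : x ∈ supp f := hYU ▸ Set.mem_iUnion_of_mem l hx
      exact this
    have hres : (law g).restrict (Y l) = law g := by
      have h := congrArg (fun μ => p⁻¹ • μ.restrict (Y l)) hlaw
      have h' := congrArg (fun μ => p⁻¹ • μ) hlaw
      simp only [Measure.restrict_smul, Measure.restrict_restrict (hYm l), Set.inter_self,
        smul_smul, ENNReal.inv_mul_cancel h0 hpt, one_smul] at h h'
      rw [h, h']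
    have hmass : ∫⁻ x, ENNReal.ofReal (g x) = (law g) Set.univ := by
      rw [law, withDensity_apply _ MeasurableSet.univ, Measure.restrict_univ]
    have hone : (law g) Set.univ = 1 := by
      have h := congrArg (fun μ => μ Set.univ) hlaw
      simp only [Measure.smul_apply, Measure.restrict_apply_univ, smul_eq_mul] at h
      exact (ENNReal.mul_right_inj h0 hpt).1 (h.trans (mul_one _).symm)
    have hY : ∀ᵐ x ∂law g, x ∈ Y l := hres ▸ ae_restrict_mem (hYm l)
    calc ∫⁻ x in Y l, ENNReal.ofReal (log (f x)) ∂law f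
        = p * ∫⁻ x, ENNReal.ofReal (log (f x)) ∂law g := by
          rw [← hlaw, lintegral_smul_measure, smul_eq_mul]
      _ ≤ p * ∫⁻ x, ((logOsc g (C l) x).toENNReal +
            d * ENNReal.ofReal (max (log (1 / r l)) 0)) ∂law g := by
          refine mul_le_mul' le_rfl (lintegral_mono_ae ?_)
          filter_upwards [hY] with x hx
          obtain ⟨hfx, hgx⟩ := hgf x hx
          have hgx0 : 0 < g x := by
            rw [hgx]
            positivity
          obtain ⟨⟨a, ha⟩, -⟩ := hw.cube x hgx0
          refine le_trans ?_ (ofReal_log_le_logOsc (hmass.trans hone).le hw.scale_pos ha hgx0)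
          refine ENNReal.ofReal_le_ofReal (log_le_log hfx ?_)
          rw [hgx]
          exact le_div_self hfx.le hp0 hp1
      _ = _ := by
          rw [lintegral_add_right _ measurable_const, lintegral_const, hone, hres]
          ring
  rw [← Measure.restrict_eq_self_of_ae_mem hmem, lintegral_iUnion hYm hYd]
  refine ne_top_of_le_ne_top ?_ (ENNReal.tsum_le_tsum hle)
  rw [ENNReal.tsum_add, ENNReal.tsum_mul_left]
  exact ENNReal.add_ne_top.2 ⟨hD.ne, ENNReal.mul_ne_top (ENNReal.natCast_ne_top d) hr.ne⟩

/-! ### Finite divergence from a Gaussian mixture -/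

/-- A weak form of Young's inequality `a b ≤ a log a - a + e^b`. The absolute value makes both
summands on the right nonnegative, so that they can be integrated separately. -/
lemma mul_le_mul_log_add_exp {a : ℝ} (ha : 0 ≤ a) (b : ℝ) : a * b ≤ a * |log a| + exp b := by
  rcases ha.eq_or_lt with rfl | ha
  · simp [(exp_pos b).le]
  have h1 : b - log a + 1 ≤ exp b / a := by
    have := add_one_le_exp (b - log a)
    rwa [exp_sub, exp_log ha] at this
  have h2 := mul_le_mul_of_nonneg_left h1 ha.le
  rw [mul_div_cancel₀ _ ha.ne'] at h2
  have h3 := mul_le_mul_of_nonneg_left (le_abs_self (log a)) ha.le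
  nlinarith

/-- If `e^φ` is integrable under `ν`, then the positive part of `φ` is integrable under every `μ`
of finite divergence from `ν`. -/
lemma lintegral_ne_top_of_klDiv_ne_top {α : Type*} [MeasurableSpace α] {μ ν : Measure α}
    [SigmaFinite μ] [SigmaFinite ν] (h : InformationTheory.klDiv μ ν ≠ ⊤) {φ : α → ℝ}
    (hφ : Measurable φ) (hexp : ∫⁻ x, ENNReal.ofReal (exp (φ x)) ∂ν ≠ ⊤) :
    ∫⁻ x, ENNReal.ofReal (φ x) ∂μ ≠ ⊤ := by
  obtain ⟨hac, hint⟩ := InformationTheory.klDiv_ne_top_iff.1 h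
  have hl : Measurable fun x => ENNReal.ofReal |llr μ ν x| :=
    (continuous_abs.measurable.comp (measurable_llr μ ν)).ennreal_ofReal
  have hfin : ∫⁻ x, ENNReal.ofReal |llr μ ν x| ∂μ ≠ ⊤ := by
    have := hint.hasFiniteIntegral
    rw [hasFiniteIntegral_iff_norm] at this
    exact this.ne
  rw [← lintegral_rnDeriv_mul hac hφ.ennreal_ofReal.aemeasurable]
  rw [← lintegral_rnDeriv_mul hac hl.aemeasurable] at hfin
  refine ne_top_of_le_ne_top (ENNReal.add_ne_top.2 ⟨hfin, hexp⟩) ?_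
  rw [← lintegral_add_right _ hφ.exp.ennreal_ofReal]
  refine lintegral_mono_ae ?_
  filter_upwards [Measure.rnDeriv_lt_top μ ν] with x hx
  rw [llr]
  set a := (μ.rnDeriv ν x).toReal with ha
  have ha0 : 0 ≤ a := ENNReal.toReal_nonneg
  rw [← ENNReal.ofReal_toReal hx.ne, ← ha, ← ENNReal.ofReal_mul ha0, ← ENNReal.ofReal_mul ha0,
    ← ENNReal.ofReal_add (by positivity) (exp_pos _).le]
  exact ENNReal.ofReal_le_ofReal (mul_le_mul_log_add_exp ha0 _)

/-- The constant is the minimum of the quadratic form on the unit sphere. -/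
lemma exists_pos_mul_norm_sq_le {M : Matrix (Fin d) (Fin d) ℝ} (hM : M.PosDef) :
    ∃ b : ℝ, 0 < b ∧ ∀ x : E d, b * ‖x‖ ^ 2 ≤ x.ofLp ⬝ᵥ (M *ᵥ x.ofLp) := by
  let q : E d → ℝ := fun x => x.ofLp ⬝ᵥ (M *ᵥ x.ofLp)
  have hq : Continuous q := by
    have : Continuous (fun x : E d => x.ofLp) := PiLp.continuous_ofLp 2 _
    exact this.dotProduct (continuous_const.matrix_mulVec this)
  have hpos : ∀ x : E d, x ≠ 0 → 0 < q x := fun x hx => by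
    have := hM.dotProduct_mulVec_pos (x := x.ofLp) (by simpa using hx)
    simpa using this
  rcases (Metric.sphere (0 : E d) 1).eq_empty_or_nonempty with h0 | hne
  -- The sphere is empty only in dimension zero, where any constant will do.
  · refine ⟨1, one_pos, fun x => ?_⟩
    have hx : x = 0 := by
      by_contra hx
      have : ‖x‖⁻¹ • x ∈ Metric.sphere (0 : E d) 1 := by
        simp [norm_smul, norm_ne_zero_iff.2 hx]
      simp [h0] at this
    simp [hx]
  obtain ⟨z, hz, hmin⟩ := (isCompact_sphere (0 : E d) 1).exists_isMinOn hne hq.continuousOn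
  have hz0 : z ≠ 0 := by
    rintro rfl
    simp at hz
  refine ⟨q z, hpos z hz0, fun x => ?_⟩
  rcases eq_or_ne x 0 with rfl | hx
  · simp
  have hn : ‖x‖ ≠ 0 := norm_ne_zero_iff.2 hx
  have hmem : ‖x‖⁻¹ • x ∈ Metric.sphere (0 : E d) 1 := by simp [norm_smul, hn]
  have h1 : q z ≤ q (‖x‖⁻¹ • x) := hmin hmem
  have h2 : q (‖x‖⁻¹ • x) = (‖x‖ ^ 2)⁻¹ * q x := by
    simp only [q, WithLp.ofLp_smul, Matrix.mulVec_smul, dotProduct_smul, smul_dotProduct,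
      smul_eq_mul]
    field_simp
  rw [h2, ← div_eq_inv_mul, le_div_iff₀ (by positivity)] at h1
  exact h1

lemma integrable_exp_neg_mul_norm_sq {b : ℝ} (hb : 0 < b) :
    Integrable fun v : E d => exp (-b * ‖v‖ ^ 2) := by
  by_contra h
  have h1 := GaussianFourier.integral_rexp_neg_mul_sq_norm (V := E d) hb
  rw [integral_undef h] at h1
  have : 0 < (π / b) ^ ((Module.finrank ℝ (E d) : ℝ) / 2) := by positivity
  exact this.ne h1

lemma measurable_gaussianDensity (μ : E d) (S : Matrix (Fin d) (Fin d) ℝ) :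
    Measurable (gaussianDensity μ S) := by
  have h1 : Continuous fun x : E d => (x - μ).ofLp :=
    (PiLp.continuous_ofLp 2 _).comp (by fun_prop)
  have h2 : Continuous fun x : E d => (x - μ).ofLp ⬝ᵥ (S⁻¹ *ᵥ (x - μ).ofLp) :=
    h1.dotProduct (continuous_const.matrix_mulVec h1)
  exact (((continuous_const.mul h2).rexp).const_mul _).measurable

lemma eventually_integrable_gaussianDensity_mul_exp (μ : E d) {S : Matrix (Fin d) (Fin d) ℝ}
    (hS : S.PosDef) :
    ∀ᶠ c in 𝓝[>] (0 : ℝ), Integrable fun x => gaussianDensity μ S x * exp (c * ‖x‖ ^ 2) := by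
  obtain ⟨b, hb, hle⟩ := exists_pos_mul_norm_sq_le hS.inv
  -- As `‖x‖² ≤ 2 ‖x - μ‖² + 2 ‖μ‖²`, for `c < b / 8` the factor `exp (c ‖x‖²)` uses up at most half
  -- of the decay `exp (-(b / 2) ‖x - μ‖²)` of the Gaussian density.
  filter_upwards [Ioo_mem_nhdsGT (show (0 : ℝ) < b / 8 by positivity)] with c hc
  have hdet := hS.det_pos
  obtain ⟨K, hK⟩ : ∃ K : ℝ, K = (2 * π) ^ (-(d : ℝ) / 2) * S.det ^ (-(1 / 2) : ℝ) := ⟨_, rfl⟩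
  have hK0 : 0 < K := by
    rw [hK]
    positivity
  have hi : Integrable fun x : E d =>
      K * exp (2 * c * ‖μ‖ ^ 2) * exp (-(b / 4) * ‖x - μ‖ ^ 2) :=
    ((integrable_exp_neg_mul_norm_sq (by positivity)).comp_sub_right μ).const_mul _
  refine hi.mono' ((measurable_gaussianDensity μ S).mul (by fun_prop)).aestronglyMeasurable
    (Eventually.of_forall fun x => ?_)
  rw [gaussianDensity, ← hK, norm_eq_abs, abs_of_pos (by positivity), mul_assoc, mul_assoc,
    ← exp_add, ← exp_add]
  refine mul_le_mul_of_nonneg_left (exp_le_exp.2 ?_) hK0.le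
  have h1 : ‖x‖ ^ 2 ≤ 2 * ‖x - μ‖ ^ 2 + 2 * ‖μ‖ ^ 2 := by
    have h2 : ‖x‖ ≤ ‖x - μ‖ + ‖μ‖ := by simpa using norm_add_le (x - μ) μ
    nlinarith [norm_nonneg x, sq_nonneg (‖x - μ‖ - ‖μ‖)]
  have h3 := hle (x - μ)
  have h4 := mul_le_mul_of_nonneg_left h1 hc.1.le
  nlinarith [mul_le_mul_of_nonneg_right hc.2.le (sq_nonneg ‖x - μ‖)]

/-- Gaussian mixtures have a Gaussian exponential moment. -/
lemma exists_lintegral_exp_ne_top {g : E d → ℝ} (hg : g ∈ mixtures d) :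
    ∃ c : ℝ, 0 < c ∧ ∫⁻ x, ENNReal.ofReal (exp (c * ‖x‖ ^ 2)) ∂law g ≠ ⊤ := by
  obtain ⟨m, w, μ, S, hw, -, hS, rfl⟩ := hg
  have hev := eventually_all.2 fun j =>
    eventually_integrable_gaussianDensity_mul_exp (μ j) (hS j)
  obtain ⟨c, hc, hc0⟩ := (hev.and self_mem_nhdsWithin).exists
  refine ⟨c, hc0, ?_⟩
  have hm : Measurable fun x => ∑ j, w j * gaussianDensity (μ j) (S j) x :=
    Finset.measurable_fun_sum _ fun j _ => (measurable_gaussianDensity _ _).const_mul _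
  rw [lintegral_law hm (by fun_prop)]
  have hi : Integrable fun x => (∑ j, w j * gaussianDensity (μ j) (S j) x) *
      exp (c * ‖x‖ ^ 2) := by
    simp only [Finset.sum_mul, mul_assoc]
    exact integrable_finsetSum _ fun j _ => (hc j).const_mul _
  refine ne_top_of_le_ne_top hi.lintegral_lt_top.ne (lintegral_mono fun x => ?_)
  dsimp only
  rw [← ENNReal.ofReal_mul' (exp_pos _).le]

/-- Finite divergence from a single Gaussian mixture forces a finite second moment. -/
lemma lintegral_norm_sq_ne_top_of_KL_ne_top {f g : E d → ℝ} (hf : IsDensity f)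
    (hg : g ∈ mixtures d) (h : KL f g ≠ ⊤) : ∫⁻ x, ENNReal.ofReal (‖x‖ ^ 2) ∂law f ≠ ⊤ := by
  have := hf.isProbabilityMeasure_law
  obtain ⟨c, hc, hexp⟩ := exists_lintegral_exp_ne_top hg
  have : SigmaFinite (law g) := SigmaFinite.withDensity_ofReal _
  have h1 := lintegral_ne_top_of_klDiv_ne_top h (by fun_prop) hexp
  simp only [ENNReal.ofReal_mul hc.le] at h1
  rw [lintegral_const_mul _ (by fun_prop)] at h1
  intro h2
  rw [h2, ENNReal.mul_top (by simpa using hc)] at h1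
  exact h1 rfl

end GMM

theorem theorem4p15 {d : ℕ} (f : GMM.E d → ℝ) (hf : GMM.IsDensity f) (hF : GMM.IsCSSA f) :
    (⨅ g ∈ GMM.mixtures d, GMM.KL f g) = 0 ↔
      ∫⁻ x, ENNReal.ofReal (‖x‖ ^ 2 * f x) < ⊤ := by
  have hmom : ∫⁻ x, ENNReal.ofReal (‖x‖ ^ 2 * f x) =
      ∫⁻ x, ENNReal.ofReal (‖x‖ ^ 2) ∂GMM.law f := by
    rw [GMM.lintegral_law hf.measurable (by fun_prop)]
    refine MeasureTheory.lintegral_congr fun x => ?_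
    rw [← ENNReal.ofReal_mul (hf.nonneg x), mul_comm]
  rw [hmom, lt_top_iff_ne_top]
  refine ⟨fun h => ?_, GMM.iInf_KL_eq_zero hf (hF.lintegral_log_ne_top hf)⟩
  have hlt : (⨅ g ∈ GMM.mixtures d, GMM.KL f g) < ⊤ := h ▸ ENNReal.zero_lt_top
  obtain ⟨g, hg, hKL⟩ : ∃ g, ∃ _ : g ∈ GMM.mixtures d, GMM.KL f g < ⊤ := by
    simpa only [iInf_lt_iff] using hlt
  exact GMM.lintegral_norm_sq_ne_top_of_KL_ne_top hf hg hKL.ne
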